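/- Let $G=(V,E)$ be a simple connected bipartite graph on the vertex set $\{1,\dots,N\}$ with $N\ge 3$, let $d_1,\dots,d_N$ be its vertex degrees, and let $$R^+(G)=\sum_{i<j}(d_i+d_j)R_{ij}$$ be its additive degree-Kirchhoff index, where $R_{ij}$ is the effective resistance between the vertices $i$ and $j$ when every edge is a unit resistor. Let $\lambda_1\ge\lambda_2\ge\dots\ge\lambda_N$ be the eigenvalues, with multiplicity, of the transition matrix $P$ of the simple random walk on $G$ ($P_{vw}=1/d_v$ if $v$ and $w$ are adjacent, and $P_{vw}=0$ otherwise), and put $$k=\left\lfloor\frac{\lambda_2(N-1)+1}{\lambda_2+1}\right\rfloor,\qquad \theta=\lambda_2(N-k-2)-k+2 .$$ Then $-1<\lambda_2<1$, $\theta>0$, and $$R^+(G)\le N\left(\frac12+\frac{N-k-3}{1-\lambda_2}+\frac k2+\frac1\theta\right)+\frac1{1-\lambda_2}\left(2|E|\sum_{j=1}^N\frac1{d_j}-N\right).$$ Equality holds if $G$ is the star on $N$ vertices, where both sides equal $3N^2-7N+4$, and if $N$ is even and $G$ is the complete bipartite graph $K_{N/2,N/2}$, where both sides equal $N(2N-3)$.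 -/

import Mathlib

namespace DegreeKirchhoff

noncomputable section

section General

variable {V : Type*} [Fintype V] [DecidableEq V] (G : SimpleGraph V) [DecidableRel G.Adj]

/-- `p` is the vector of potentials (voltages) on the vertices of `G`, all edges being unit
resistors, when a unit current enters at `i` and leaves at `j`: by Ohm's and Kirchhoff's laws,
`∑_{w ~ v} (p v - p w) = δ_{vi} - δ_{vj}` at every vertex `v`, that is `L p = e_i - e_j` with `L`
the Laplacian matrix of `G`. -/
def IsPotential (i j : V) (p : V → ℝ) : Prop :=
  Matrix.mulVec (G.lapMatrix ℝ) p = Pi.single i 1 - Pi.single j 1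

/-- The effective resistance between `i` and `j`: the potential difference between `i` and `j` when
a unit current enters at `i` and leaves at `j`. In a connected graph this number exists and is
unique, see `existsUnique_potential_difference` below. -/
def effectiveResistance (i j : V) : ℝ :=
  Classical.epsilon fun r : ℝ => ∃ p : V → ℝ, IsPotential G i j p ∧ r = p i - p j

/-- The transition matrix of the simple random walk on `G`: `p(v,w) = 1/d_v` if `w` is a neighbour
of `v`, and `0` otherwise. -/
def transitionMatrix : Matrix V V ℝ :=
  Matrix.of fun v w => if G.Adj v w then 1 / (G.degree v : ℝ) else 0

/-- The eigenvalues `λ₁ ≥ λ₂ ≥ ⋯ ≥ λ_N` of the transition matrix, listed with (algebraic)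
multiplicity in non-increasing order. -/
def transitionEigenvalues : List ℝ :=
  (transitionMatrix G).charpoly.roots.sort (fun a b => a ≥ b)

/-- The second largest eigenvalue `λ₂` of the transition matrix, counted with multiplicity
(the entry with index `1` of the list that starts at index `0`). -/
def secondEigenvalue : ℝ := (transitionEigenvalues G).getD 1 0

/-- `k = ⌊(λ₂ (N - 1) + 1) / (λ₂ + 1)⌋`. -/
def kParam : ℤ :=
  ⌊(secondEigenvalue G * ((Fintype.card V : ℝ) - 1) + 1) / (secondEigenvalue G + 1)⌋

/-- `θ = λ₂ (N - k - 2) - k + 2`. -/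
def thetaParam : ℝ :=
  secondEigenvalue G * ((Fintype.card V : ℝ) - (kParam G : ℝ) - 2) - (kParam G : ℝ) + 2

/-- `N (1/2 + (N - k - 3)/(1 - λ₂) + k/2 + 1/θ) + (2|E| ∑_j 1/d_j - N)/(1 - λ₂)`. -/
def bipartiteBound : ℝ :=
  (Fintype.card V : ℝ) *
      (1 / 2 + ((Fintype.card V : ℝ) - (kParam G : ℝ) - 3) / (1 - secondEigenvalue G)
        + (kParam G : ℝ) / 2 + 1 / thetaParam G)
    + 1 / (1 - secondEigenvalue G) *
      (2 * (G.edgeFinset.card : ℝ) * ∑ j : V, 1 / (G.degree j : ℝ) - (Fintype.card V : ℝ))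

/-- In a connected graph the potential difference that defines the effective resistance exists and
does not depend on the choice of the potential. -/
theorem existsUnique_potential_difference (hG : G.Connected) (i j : V) :
    ∃! r : ℝ, ∃ p : V → ℝ, IsPotential G i j p ∧ r = p i - p j := by
  have hker : ∀ x : V → ℝ, Matrix.mulVec (G.lapMatrix ℝ) x = 0 → ∀ a b : V, x a = x b :=
    fun x hx a b =>
      (G.lapMatrix_mulVec_eq_zero_iff_forall_reachable).1 hx a b (hG.preconnected a b)
  obtain ⟨p, hp⟩ : ∃ p : V → ℝ, IsPotential G i j p := by
    have hs : (Matrix.toEuclideanLin (G.lapMatrix ℝ)).IsSymmetric :=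
      Matrix.isSymmetric_toEuclideanLin_iff.2 (G.isHermitian_lapMatrix ℝ)
    have hmem : WithLp.toLp 2 (Pi.single i 1 - Pi.single j 1 : V → ℝ) ∈
        LinearMap.range (Matrix.toEuclideanLin (G.lapMatrix ℝ)) := by
      rw [← Submodule.orthogonal_orthogonal
        (LinearMap.range (Matrix.toEuclideanLin (G.lapMatrix ℝ))), hs.orthogonal_range,
        Submodule.mem_orthogonal]
      intro u hu
      have hu' : Matrix.mulVec (G.lapMatrix ℝ) u.ofLp = 0 := by
        have := congrArg WithLp.ofLp (LinearMap.mem_ker.1 hu)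
        simpa using this
      have := hker _ hu' i j
      simp [PiLp.inner_apply, sub_mul, Finset.sum_sub_distrib, this]
    obtain ⟨q, hq⟩ := hmem
    exact ⟨q.ofLp, by simpa [IsPotential] using congrArg WithLp.ofLp hq⟩
  refine ⟨p i - p j, ⟨p, hp, rfl⟩, ?_⟩
  rintro r ⟨q, hq, rfl⟩
  have h0 : Matrix.mulVec (G.lapMatrix ℝ) (q - p) = 0 := by
    rw [Matrix.mulVec_sub]
    unfold IsPotential at hp hq
    rw [hp, hq, sub_self]
  have := hker _ h0 i j
  simp only [Pi.sub_apply] at this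
  linarith

/-- The effective resistance may be computed from any potential. -/
theorem effectiveResistance_eq (hG : G.Connected) {i j : V} {p : V → ℝ}
    (hp : IsPotential G i j p) : effectiveResistance G i j = p i - p j := by
  have h := existsUnique_potential_difference G hG i j
  exact h.unique (Classical.epsilon_spec h.exists) ⟨p, hp, rfl⟩

end General

/-- The additive degree-Kirchhoff index `R⁺(G) = ∑_{i<j} (d_i + d_j) R_ij` of a graph with vertices
numbered by `Fin N`. -/
def additiveDegreeKirchhoff {N : ℕ} (G : SimpleGraph (Fin N)) [DecidableRel G.Adj] : ℝ :=
  ∑ i : Fin N, ∑ j ∈ Finset.Ioi i,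
    ((G.degree i : ℝ) + (G.degree j : ℝ)) * effectiveResistance G i j

end

end DegreeKirchhoff

/-! The matrix `P` is similar to the symmetric matrix `D^(-1/2) A D^(-1/2)`, hence has
eigenfunctions `w k` orthonormal for the degree weights. Solving the potential equation in this
basis gives `R_ij = ∑ (w k i - w k j)² / (1 - lam k)` over all `k` except the simple eigenvalue 1.
Summing `d_i R_ij` over ordered pairs, orthogonality to constants removes the cross terms and leaves
`R⁺ = ∑ (N + W k) / (1 - lam k)` with `W k = 2|E| ∑ j, (w k j)²`.

The `N` part is a convexity problem: the `N - 1` remaining eigenvalues lie in `[-1, λ₂]` and sum to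
`-1` (zero trace), so `∑ 1 / (1 - lam k)` is largest when all but one sit at the endpoints; `k`
counts those at `-1`, and `θ` is `1 - c` for the exceptional value `c` (`sum_inv_le`). For the `W`
part, the total mass is `2|E| ∑ 1/d_j`; the eigenvalues `1` and `-1` each carry mass `N`, since
their eigenfunctions have constant modulus. The `-1` term contributes `N/2` and every other
denominator is at least `1 - λ₂`.

If `λ₂ = 0`, the spectrum is `1, 0, …, 0, -1` and both estimates are exact; this covers the star and
`K_{m,m}`. -/

open Matrix Finset

namespace DegreeKirchhoff

/-! ### Diagonalisation of the random walk -/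

section Spectral

variable {V : Type*} [Fintype V] [DecidableEq V] (G : SimpleGraph V) [DecidableRel G.Adj]

/-- A full system of eigenfunctions `w k` of the random walk on `G`, with eigenvalues `lam k`,
orthonormal with respect to the degree weights. -/
structure IsEigensystem (lam : V → ℝ) (w : V → V → ℝ) : Prop where
  roots_eq : (transitionMatrix G).charpoly.roots = (univ : Finset V).val.map lam
  sum_neighbors : ∀ k v, ∑ x ∈ G.neighborFinset v, w k x = lam k * G.degree v * w k v
  orthonormal : ∀ k l, ∑ v, (G.degree v : ℝ) * w k v * w l v = if k = l then 1 else 0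
  resolution : ∀ v x, ∑ k, w k v * w k x = if v = x then 1 / (G.degree v : ℝ) else 0

/-- Eigenvectors of the symmetric matrix `S`, rescaled by `D^(-1/2)`. Orthonormality and resolution
of the identity are `Uᵀ U = 1` and `U Uᵀ = 1` after this rescaling. -/
theorem exists_isEigensystem (hd : ∀ v, 0 < G.degree v) :
    ∃ lam w, IsEigensystem G lam w := by
  let r : V → ℝ := fun v => (Real.sqrt (G.degree v))⁻¹
  have hpos : ∀ v, 0 < Real.sqrt (G.degree v) := fun v =>
    Real.sqrt_pos.2 (by exact_mod_cast hd v)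
  have hsq : ∀ v, Real.sqrt (G.degree v) * Real.sqrt (G.degree v) = G.degree v := fun v =>
    Real.mul_self_sqrt (Nat.cast_nonneg _)
  let S : Matrix V V ℝ := (diagonal r * G.adjMatrix ℝ) * diagonal r
  have hS : S.IsHermitian := by
    change Sᴴ = S
    simp [S, Matrix.mul_assoc]
  have hP : (transitionMatrix G).charpoly = S.charpoly := by
    rw [Matrix.charpoly_mul_comm]
    congr 1
    ext v x
    have : r v * r v = 1 / (G.degree v : ℝ) := by
      simp only [r]
      rw [← mul_inv, hsq, one_div]
    rw [← Matrix.mul_assoc, Matrix.diagonal_mul_diagonal, Matrix.diagonal_mul, this]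
    simp [transitionMatrix]
  have hentry : ∀ v x, S v x = r v * r x * (if G.Adj v x then 1 else 0) := by
    intro v x
    simp only [S, Matrix.mul_diagonal, Matrix.diagonal_mul, SimpleGraph.adjMatrix_apply]
    ring
  let U : Matrix V V ℝ := fun v k => hS.eigenvectorBasis k v
  have hUU : U = (hS.eigenvectorUnitary : Matrix V V ℝ) := by
    ext v k
    simp [U, IsHermitian.eigenvectorUnitary_apply]
  have h1 : Uᵀ * U = 1 := by
    have := (Matrix.mem_unitaryGroup_iff' (A := U)).1 (hUU ▸ hS.eigenvectorUnitary.2)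
    simpa [Matrix.star_eq_conjTranspose] using this
  have h2 : U * Uᵀ = 1 := mul_eq_one_comm.1 h1
  refine ⟨hS.eigenvalues, fun k v => r v * U v k, ?_, ?_, ?_, ?_⟩
  · rw [hP, hS.roots_charpoly_eq_eigenvalues]
    rfl
  · intro k v
    have := congrFun (hS.mulVec_eigenvectorBasis k) v
    simp only [mulVec, dotProduct, hentry, Pi.smul_apply, smul_eq_mul] at this
    rw [← SimpleGraph.adjMatrix_mulVec_apply]
    simp only [mulVec, dotProduct, SimpleGraph.adjMatrix_apply]
    have h3 : ∑ x, (if G.Adj v x then (1 : ℝ) else 0) * (r x * U x k) =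
        Real.sqrt (G.degree v) * ∑ x, r v * r x * (if G.Adj v x then 1 else 0) *
          (hS.eigenvectorBasis k).ofLp x := by
      rw [Finset.mul_sum]
      refine Finset.sum_congr rfl fun x _ => ?_
      have : Real.sqrt (G.degree v) * r v = 1 := mul_inv_cancel₀ (hpos v).ne'
      simp only [U]
      linear_combination (-(r x) * (if G.Adj v x then (1 : ℝ) else 0) *
          (hS.eigenvectorBasis k).ofLp x) * this
    rw [h3, this]
    have : (G.degree v : ℝ) * r v = Real.sqrt (G.degree v) := by
      nth_rewrite 1 [← hsq v]
      exact mul_inv_cancel_right₀ (hpos v).ne' _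
    simp only [U]
    linear_combination (-(hS.eigenvalues k) * (hS.eigenvectorBasis k).ofLp v) * this
  · intro k l
    have := congrFun (congrFun h1 k) l
    simp only [Matrix.mul_apply, Matrix.transpose_apply, Matrix.one_apply] at this
    rw [← this]
    refine Finset.sum_congr rfl fun v _ => ?_
    have : (G.degree v : ℝ) * (r v * r v) = 1 := by
      simp only [r]
      rw [← mul_inv, hsq]
      exact mul_inv_cancel₀ (by exact_mod_cast (hd v).ne')
    linear_combination (U v k * U v l) * this
  · intro v x
    have := congrFun (congrFun h2 v) x
    simp only [Matrix.mul_apply, Matrix.transpose_apply, Matrix.one_apply] at this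
    calc ∑ k, r v * U v k * (r x * U x k) = r v * r x * ∑ k, U v k * U x k := by
          rw [Finset.mul_sum]
          exact Finset.sum_congr rfl fun k _ => by ring
      _ = _ := by
          rw [this]
          split_ifs with h
          · subst h
            simp only [r]
            rw [← mul_inv, hsq, one_div, mul_one]
          · simp

end Spectral

/-! ### Spectrum of a connected bipartite graph and effective resistances -/

section Eigensystem

variable {V : Type*} [Fintype V] [DecidableEq V] {G : SimpleGraph V} [DecidableRel G.Adj]

omit [DecidableEq V] in
theorem sum_mul_sum_neighbors_comm (f g : V → ℝ) :
    ∑ v, f v * ∑ x ∈ G.neighborFinset v, g x = ∑ v, g v * ∑ x ∈ G.neighborFinset v, f x := by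
  simp only [← SimpleGraph.adjMatrix_mulVec_apply]
  change f ⬝ᵥ (G.adjMatrix ℝ *ᵥ g) = g ⬝ᵥ (G.adjMatrix ℝ *ᵥ f)
  rw [Matrix.dotProduct_mulVec, ← Matrix.mulVec_transpose, SimpleGraph.transpose_adjMatrix,
    dotProduct_comm]

/-- The Laplacian is positive semidefinite, and its quadratic form at `f` is `(1 - μ) ∑ d f²`. -/
theorem eigenvalue_le_one {f : V → ℝ} {μ : ℝ}
    (hf : ∀ v, ∑ x ∈ G.neighborFinset v, f x = μ * G.degree v * f v)
    (hnorm : ∑ v, (G.degree v : ℝ) * f v * f v = 1) : μ ≤ 1 := by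
  have h := (SimpleGraph.posSemidef_lapMatrix ℝ G).dotProduct_mulVec_nonneg f
  have : star f ⬝ᵥ (G.lapMatrix ℝ *ᵥ f) = (1 - μ) * ∑ v, (G.degree v : ℝ) * f v * f v := by
    rw [star_trivial, dotProduct, Finset.mul_sum]
    refine Finset.sum_congr rfl fun v _ => ?_
    rw [SimpleGraph.lapMatrix_mulVec_apply, hf]
    ring
  rw [this, hnorm] at h
  linarith

theorem eq_of_eigenvalue_one (hG : G.Connected) {f : V → ℝ}
    (hf : ∀ v, ∑ x ∈ G.neighborFinset v, f x = G.degree v * f v) (v x : V) : f v = f x := by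
  refine (G.lapMatrix_mulVec_eq_zero_iff_forall_reachable (x := f)).1 ?_ v x (hG.preconnected v x)
  ext v
  rw [SimpleGraph.lapMatrix_mulVec_apply, hf, sub_self, Pi.zero_apply]

omit [DecidableEq V] in
/-- A bipartite graph has a `±1`-valued function that changes sign along every edge. -/
theorem exists_sign (hbip : G.IsBipartite) :
    ∃ s : V → ℝ, (∀ v, s v * s v = 1) ∧ ∀ v, ∀ x ∈ G.neighborFinset v, s x = -s v := by
  obtain ⟨c⟩ := hbip
  refine ⟨fun v => if c v = 0 then 1 else -1, fun v => by dsimp only; split_ifs <;> norm_num, ?_⟩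
  intro v x hx
  have hne : c v ≠ c x := c.valid ((SimpleGraph.mem_neighborFinset _ _ _).1 hx)
  by_cases h0 : c v = 0 <;> by_cases h1 : c x = 0 <;> simp [h0, h1] <;> omega

omit [DecidableEq V] in
theorem cast_sum_degrees : ∑ v, (G.degree v : ℝ) = 2 * (G.edgeFinset.card : ℝ) := by
  exact_mod_cast G.sum_degrees_eq_twice_card_edges

namespace IsEigensystem

variable {lam : V → ℝ} {w : V → V → ℝ}

theorem norm_eq (h : IsEigensystem G lam w) (k : V) :
    ∑ v, (G.degree v : ℝ) * w k v * w k v = 1 := by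
  rw [h.orthonormal, if_pos rfl]

theorem le_one (h : IsEigensystem G lam w) (k : V) : lam k ≤ 1 :=
  eigenvalue_le_one (h.sum_neighbors k) (h.norm_eq k)

theorem sum_neighbors_sign (h : IsEigensystem G lam w) {s : V → ℝ}
    (hadj : ∀ v, ∀ x ∈ G.neighborFinset v, s x = -s v) (k v : V) :
    ∑ x ∈ G.neighborFinset v, s x * w k x = -lam k * G.degree v * (s v * w k v) := by
  rw [Finset.sum_congr rfl fun x hx => by rw [hadj v x hx], ← Finset.mul_sum, h.sum_neighbors]
  ring

/-- Multiplying by the bipartition sign turns an eigenfunction for `lam k` into one for `-lam k`. -/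
theorem neg_one_le (h : IsEigensystem G lam w) (hbip : G.IsBipartite) (k : V) : -1 ≤ lam k := by
  obtain ⟨s, hs, hadj⟩ := exists_sign hbip
  have := eigenvalue_le_one (f := fun x => s x * w k x) (h.sum_neighbors_sign hadj k) (by
    rw [← h.norm_eq k]
    refine Finset.sum_congr rfl fun v _ => ?_
    linear_combination (G.degree v * w k v * w k v) * hs v)
  linarith

/-- If `μ` were missing from the list, `s` would be orthogonal to every `w k`, and the resolution of
the identity would force `s v = 0`. -/
theorem exists_eq (h : IsEigensystem G lam w) {v : V} (hd : 0 < G.degree v) {s : V → ℝ}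
    {μ : ℝ} (hv : s v ≠ 0)
    (hs : ∀ v, ∑ x ∈ G.neighborFinset v, s x = μ * G.degree v * s v) : ∃ k, lam k = μ := by
  by_contra! hne
  have hzero : ∀ k, ∑ x, (G.degree x : ℝ) * w k x * s x = 0 := by
    intro k
    have := sum_mul_sum_neighbors_comm (G := G) s (w k)
    simp only [hs, h.sum_neighbors] at this
    have h2 : (lam k - μ) * ∑ x, (G.degree x : ℝ) * w k x * s x = 0 := by
      rw [sub_mul, Finset.mul_sum, Finset.mul_sum, sub_eq_zero]
      convert this using 2 <;> ring
    exact (mul_eq_zero.1 h2).resolve_left (sub_ne_zero.2 (hne k))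
  have hsum : ∑ k, w k v * ∑ x, (G.degree x : ℝ) * w k x * s x =
      ∑ x, (G.degree x : ℝ) * s x * ∑ k, w k v * w k x := by
    simp only [Finset.mul_sum]
    rw [Finset.sum_comm]
    exact Finset.sum_congr rfl fun x _ => Finset.sum_congr rfl fun k _ => by ring
  simp only [hzero, h.resolution, mul_zero, Finset.sum_const_zero, mul_ite,
    Finset.sum_ite_eq, Finset.mem_univ, if_true] at hsum
  have hd' : (G.degree v : ℝ) ≠ 0 := by exact_mod_cast hd.ne'
  field_simp at hsum
  exact hv hsum.symm

theorem exists_eq_one (h : IsEigensystem G lam w) [Nonempty V] (hd : ∀ v, 0 < G.degree v) :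
    ∃ k, lam k = 1 :=
  h.exists_eq (hd (Classical.arbitrary V)) (s := fun _ => 1) one_ne_zero fun v => by simp

theorem exists_eq_neg_one (h : IsEigensystem G lam w) [Nonempty V] (hd : ∀ v, 0 < G.degree v)
    (hbip : G.IsBipartite) :
    ∃ k, lam k = -1 := by
  obtain ⟨s, hs, hadj⟩ := exists_sign hbip
  refine h.exists_eq (hd (Classical.arbitrary V)) (s := s) ?_ fun v => ?_
  · intro h0
    simpa [h0] using hs (Classical.arbitrary V)
  · rw [Finset.sum_congr rfl (hadj v)]
    simp

theorem sq_of_eq_one (h : IsEigensystem G lam w) (hG : G.Connected) {k : V} (hk : lam k = 1)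
    (v : V) : 2 * (G.edgeFinset.card : ℝ) * (w k v * w k v) = 1 := by
  rw [← cast_sum_degrees, ← h.norm_eq k, Finset.sum_mul]
  refine Finset.sum_congr rfl fun x _ => ?_
  rw [eq_of_eigenvalue_one hG (f := w k) (fun v => by rw [h.sum_neighbors, hk, one_mul]) v x]
  ring

/-- The bipartition sign times `w k` is an eigenfunction for `1`, hence constant; the normalisation
`∑ d = 2|E|` fixes its square. -/
theorem sq_of_eq_neg_one (h : IsEigensystem G lam w) (hG : G.Connected) (hbip : G.IsBipartite)
    {k : V} (hk : lam k = -1) (v : V) :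
    2 * (G.edgeFinset.card : ℝ) * (w k v * w k v) = 1 := by
  obtain ⟨s, hs, hadj⟩ := exists_sign hbip
  rw [← cast_sum_degrees, ← h.norm_eq k, Finset.sum_mul]
  refine Finset.sum_congr rfl fun x _ => ?_
  have := eq_of_eigenvalue_one hG (f := fun x => s x * w k x)
    (fun v => by rw [h.sum_neighbors_sign hadj, hk]; ring) v x
  linear_combination (-(G.degree x : ℝ) * (w k v * w k v)) * hs v +
    (G.degree x : ℝ) * (w k x * w k x) * hs x +
    (G.degree x : ℝ) * (s v * w k v + s x * w k x) * this

theorem eq_of_eq_one (h : IsEigensystem G lam w) (hG : G.Connected) {k l : V} (hk : lam k = 1)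
    (hl : lam l = 1) : k = l := by
  by_contra hne
  have := h.orthonormal k l
  rw [if_neg hne] at this
  have hc : ∀ {k}, lam k = 1 → ∀ v x, w k v = w k x := fun {k} hk v x =>
    eq_of_eigenvalue_one hG (f := w k) (fun v => by rw [h.sum_neighbors, hk, one_mul]) v x
  rw [Finset.sum_congr rfl fun v _ => by rw [hc hk v k, hc hl v k, mul_assoc], ← Finset.sum_mul,
    cast_sum_degrees] at this
  have h1 := h.sq_of_eq_one hG hk k
  have h2 := h.sq_of_eq_one hG hl k
  have : (1 : ℝ) = 0 := by
    linear_combination (-1 : ℝ) * h1 + (-(2 * (G.edgeFinset.card : ℝ) * (w k k * w k k))) * h2 +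
      (2 * (G.edgeFinset.card : ℝ) * (w k k * w l k)) * this
  exact one_ne_zero this

/-- This is the vanishing of the trace: after resolution of the identity, only pairs of distinct
adjacent vertices occur. -/
theorem sum_eigenvalues (h : IsEigensystem G lam w) : ∑ k, lam k = 0 := by
  have : ∀ k, lam k = ∑ v, ∑ x ∈ G.neighborFinset v, w k v * w k x := by
    intro k
    simp_rw [← Finset.mul_sum, h.sum_neighbors]
    calc lam k = lam k * ∑ v, (G.degree v : ℝ) * w k v * w k v := by rw [h.norm_eq, mul_one]
      _ = _ := by
        rw [Finset.mul_sum]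
        exact Finset.sum_congr rfl fun v _ => by ring
  rw [Finset.sum_congr rfl fun k _ => this k, Finset.sum_comm]
  refine Finset.sum_eq_zero fun v _ => ?_
  rw [Finset.sum_comm]
  refine Finset.sum_eq_zero fun x hx => ?_
  rw [h.resolution, if_neg]
  exact G.ne_of_adj ((SimpleGraph.mem_neighborFinset _ _ _).1 hx)

/-- The spectral formula for the effective resistance. -/
theorem effectiveResistance_eq_sum (h : IsEigensystem G lam w) (hG : G.Connected)
    (hd : ∀ v, 0 < G.degree v) {k₀ : V} (hk₀ : lam k₀ = 1) (i j : V) :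
    effectiveResistance G i j =
      ∑ k ∈ univ.erase k₀, (w k i - w k j) ^ 2 / (1 - lam k) := by
  have hne : ∀ k ∈ univ.erase k₀, 1 - lam k ≠ 0 := fun k hk h0 =>
    (mem_erase.1 hk).1 (h.eq_of_eq_one hG (by linarith) hk₀)
  have hp : IsPotential G i j
      fun v => ∑ k ∈ univ.erase k₀, (w k i - w k j) / (1 - lam k) * w k v := by
    ext v
    -- The omitted index has zero coefficient, so it can be restored and the full resolution of the
    -- identity applies.
    have h0 : w k₀ i - w k₀ j = 0 := sub_eq_zero.2 <|
      eq_of_eigenvalue_one hG (f := w k₀) (fun v => by rw [h.sum_neighbors, hk₀, one_mul]) i j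
    calc _ = ∑ k ∈ univ.erase k₀, (w k i - w k j) * (G.degree v * w k v) := by
          rw [SimpleGraph.lapMatrix_mulVec_apply, Finset.sum_comm, Finset.mul_sum,
            ← Finset.sum_sub_distrib]
          refine Finset.sum_congr rfl fun k hk => ?_
          rw [← Finset.mul_sum, h.sum_neighbors]
          have := hne k hk
          field_simp
      _ = ∑ k, (w k i - w k j) * (G.degree v * w k v) := by
          rw [← Finset.sum_erase_add _ _ (mem_univ k₀), h0, zero_mul, add_zero]
      _ = G.degree v * (∑ k, w k i * w k v - ∑ k, w k j * w k v) := by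
          rw [← Finset.sum_sub_distrib, Finset.mul_sum]
          exact Finset.sum_congr rfl fun k _ => by ring
      _ = _ := by
          have : (G.degree v : ℝ) ≠ 0 := by exact_mod_cast (hd v).ne'
          rw [h.resolution, h.resolution, Pi.sub_apply, Pi.single_apply, Pi.single_apply, mul_sub]
          congr 1
          · by_cases hi : v = i
            · subst hi; simp [this]
            · simp [hi, Ne.symm hi]
          · by_cases hi : v = j
            · subst hi; simp [this]
            · simp [hi, Ne.symm hi]
  rw [effectiveResistance_eq G hG hp, ← Finset.sum_sub_distrib]
  exact Finset.sum_congr rfl fun k _ => by ring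

theorem sum_degree_mul_effectiveResistance (h : IsEigensystem G lam w) (hG : G.Connected)
    (hd : ∀ v, 0 < G.degree v) {k₀ : V} (hk₀ : lam k₀ = 1) :
    ∑ i, ∑ j, (G.degree i : ℝ) * effectiveResistance G i j =
      ∑ k ∈ univ.erase k₀,
        (Fintype.card V + 2 * (G.edgeFinset.card : ℝ) * ∑ j, w k j * w k j) / (1 - lam k) := by
  simp_rw [h.effectiveResistance_eq_sum hG hd hk₀, Finset.mul_sum]
  rw [Finset.sum_congr rfl fun i _ => Finset.sum_comm, Finset.sum_comm]
  refine Finset.sum_congr rfl fun k hk => ?_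
  -- Orthogonality to the nonzero constant `w k₀` kills the cross term of the expanded square.
  have h0 : ∑ i, (G.degree i : ℝ) * w k i = 0 := by
    have h1 := h.orthonormal k k₀
    rw [if_neg (mem_erase.1 hk).1] at h1
    have hc := fun v => eq_of_eigenvalue_one hG (f := w k₀)
      (fun v => by rw [h.sum_neighbors, hk₀, one_mul]) v k
    rw [Finset.sum_congr rfl fun v _ => by rw [hc v], ← Finset.sum_mul] at h1
    refine (mul_eq_zero.1 h1).resolve_right fun h2 => ?_
    simpa [h2] using h.sq_of_eq_one hG hk₀ k
  calc ∑ i, ∑ j, (G.degree i : ℝ) * ((w k i - w k j) ^ 2 / (1 - lam k))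
      = ∑ i, (G.degree i * w k i * w k i * Fintype.card V
          + G.degree i * (∑ j, w k j * w k j)
          - 2 * (G.degree i * w k i) * ∑ j, w k j) / (1 - lam k) := by
        refine Finset.sum_congr rfl fun i _ => ?_
        have : ∀ j, (G.degree i : ℝ) * ((w k i - w k j) ^ 2 / (1 - lam k)) =
            (G.degree i * w k i * w k i + G.degree i * (w k j * w k j)
              - 2 * (G.degree i * w k i) * w k j) / (1 - lam k) := fun j => by ring
        rw [Finset.sum_congr rfl fun j _ => this j, ← Finset.sum_div, Finset.sum_sub_distrib,
          Finset.sum_add_distrib, ← Finset.mul_sum, ← Finset.mul_sum, ← Finset.mul_sum, Finset.sum_const,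
          Finset.card_univ, nsmul_eq_mul]
        ring
    _ = _ := by
        rw [← Finset.sum_div, Finset.sum_sub_distrib, Finset.sum_add_distrib, ← Finset.sum_mul,
          ← Finset.sum_mul, ← Finset.sum_mul, ← Finset.mul_sum, h0, h.norm_eq, cast_sum_degrees]
        simp [Finset.mul_sum]

end IsEigensystem

end Eigensystem

/-! ### The extremal problem for the sum of `1 / (1 - x)` -/

section Extremal

/-- With a fixed sum the numerators over the common denominator agree, while spreading the pair
shrinks the product of denominators. -/
theorem inv_add_inv_le_of_add_eq {x y u v : ℝ} (hsum : x + y = u + v) (hux : u ≤ x) (hxv : x ≤ v)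
    (hv : v < 1) : 1 / (1 - x) + 1 / (1 - y) ≤ 1 / (1 - u) + 1 / (1 - v) := by
  obtain rfl : y = u + v - x := by linarith
  have h1 : 0 < 1 - x := by linarith
  have h2 : 0 < 1 - (u + v - x) := by linarith
  have h3 : 0 < 1 - u := by linarith
  have h4 : 0 < 1 - v := by linarith
  rw [div_add_div _ _ h1.ne' h2.ne', div_add_div _ _ h3.ne' h4.ne']
  have h5 : (1 - u) * (1 - v) ≤ (1 - x) * (1 - (u + v - x)) := by
    nlinarith [mul_nonneg (sub_nonneg.2 hux) (sub_nonneg.2 hxv)]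
  rw [show 1 * (1 - (u + v - x)) + (1 - x) * 1 = 1 * (1 - v) + (1 - u) * 1 by ring]
  exact div_le_div_of_nonneg_left (by linarith) (mul_pos h3 h4) h5

/-- For numbers in `[a, b]` with a given sum, `∑ 1 / (1 - x)` is at most its value at a
configuration in which all numbers but one are equal to `a` or `b`. -/
theorem exists_extremal_configuration {ι : Type*} {a b : ℝ} (hb : b < 1) {s : Finset ι}
    (hs : s.Nonempty) (x : ι → ℝ) (hx : ∀ i ∈ s, a ≤ x i ∧ x i ≤ b) :
    ∃ (p k : ℕ) (c : ℝ), a ≤ c ∧ c ≤ b ∧ p + k + 1 = s.card ∧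
      ∑ i ∈ s, x i = p * b + k * a + c ∧
      ∑ i ∈ s, 1 / (1 - x i) ≤ p * (1 / (1 - b)) + k * (1 / (1 - a)) + 1 / (1 - c) := by
  induction hs using Finset.Nonempty.cons_induction with
  | singleton i =>
    obtain ⟨h1, h2⟩ := hx i (by simp)
    exact ⟨0, 0, x i, h1, h2, by simp⟩
  | cons i s hi hs ih =>
    obtain ⟨p, k, c, hac, hcb, hcard, hsum, hle⟩ := ih fun j hj => hx j (mem_cons_of_mem hj)
    obtain ⟨h1, h2⟩ := hx i (mem_cons_self i s)
    simp only [sum_cons, card_cons, hsum]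
    -- Spread the new number and the old exceptional one apart until one reaches an endpoint: `a` if
    -- their sum is at most `a + b`, otherwise `b`. The other becomes the new exceptional value.
    rcases le_total (x i + c) (a + b) with h | h
    · have := inv_add_inv_le_of_add_eq (x := x i) (y := c) (u := a) (v := x i + c - a) (by ring) h1
        (by linarith) (by linarith)
      refine ⟨p, k + 1, x i + c - a, by linarith, by linarith, by omega, by push_cast; ring, ?_⟩
      push_cast
      linarith
    · have := inv_add_inv_le_of_add_eq (x := x i) (y := c) (u := x i + c - b) (v := b) (by ring)
        (by linarith) h2 hb
      refine ⟨p + 1, k, x i + c - b, by linarith, by linarith, by omega, by push_cast; ring, ?_⟩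
      push_cast
      linarith

/-- As a function of `K`, the expression drops by `b + 1` at each unit step; the floor picks the
integer that puts it in `[1 - b, 2)`, an interval of exactly that length. -/
theorem theta_bounds {n b : ℝ} {K : ℤ} (hb : -1 < b)
    (hK : K = ⌊(b * (n - 1) + 1) / (b + 1)⌋) :
    1 - b ≤ b * (n - K - 2) - K + 2 ∧ b * (n - K - 2) - K + 2 < 2 := by
  have hb' : 0 < b + 1 := by linarith
  have h1 := Int.floor_le ((b * (n - 1) + 1) / (b + 1))
  have h2 := Int.lt_floor_add_one ((b * (n - 1) + 1) / (b + 1))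
  rw [← hK, le_div_iff₀ hb'] at h1
  rw [← hK, div_lt_iff₀ hb'] at h2
  constructor <;> linarith

theorem sum_inv_le {ι : Type*} {n b : ℝ} {K : ℤ} (hb : -1 < b) (hb1 : b < 1)
    (hK : K = ⌊(b * (n - 1) + 1) / (b + 1)⌋) {s : Finset ι} (hs : s.Nonempty)
    (hn : (s.card : ℝ) = n - 1) (x : ι → ℝ) (hx : ∀ i ∈ s, -1 ≤ x i ∧ x i ≤ b)
    (hsum : ∑ i ∈ s, x i = -1) :
    ∑ i ∈ s, 1 / (1 - x i) ≤
      (n - K - 2) / (1 - b) + K / 2 + 1 / (b * (n - K - 2) - K + 2) := by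
  obtain ⟨hθ, hθ2⟩ := theta_bounds hb hK
  obtain ⟨p, k, c, hac, hcb, hcard, hsum', hle⟩ := exists_extremal_configuration hb1 hs x hx
  refine hle.trans (le_of_eq ?_)
  have hp : (p : ℝ) = n - k - 2 := by
    rw [← hcard] at hn
    push_cast at hn
    linarith
  rw [hsum, hp] at hsum'
  have hc : c = (k : ℝ) - 1 - (n - k - 2) * b := by linarith
  -- The value `1 - c` lies in `[1 - b, 2]`, closed at both ends, so the count `k` agrees with the
  -- floor `K` except possibly when `1 - c = 2`.
  have hl : -1 < (K : ℝ) - k := by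
    by_contra! h
    nlinarith
  have hu : (K : ℝ) - k ≤ 1 := by
    by_contra! h
    nlinarith
  have hl' : (-1 : ℤ) < K - k := by exact_mod_cast hl
  have hu' : K - (k : ℤ) ≤ 1 := by exact_mod_cast hu
  rw [hp]
  obtain hKk | hKk : K = k ∨ K = k + 1 := by omega
  · rw [hKk, Int.cast_natCast, hc]
    rw [show 1 - ((k : ℝ) - 1 - (n - k - 2) * b) = b * (n - k - 2) - k + 2 by ring]
    ring
  -- Boundary case `c = -1`: the exceptional number is one more copy of `-1`, and one copy of `b`
  -- now plays its role.
  · have hKr : (K : ℝ) = k + 1 := by exact_mod_cast hKk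
    rw [hKr] at hθ ⊢
    obtain rfl : c = -1 := by linarith
    have : b * (n - (k + 1) - 2) - (k + 1) + 2 = 1 - b := by linarith
    rw [this]
    have hb2 : 1 - b ≠ 0 := by linarith
    field_simp
    ring

end Extremal

/-! ### The second eigenvalue, the upper bound and the case of equality -/

namespace IsEigensystem

variable {V : Type*} [Fintype V] [DecidableEq V] {G : SimpleGraph V} [DecidableRel G.Adj]
  {lam : V → ℝ} {w : V → V → ℝ}

theorem secondEigenvalue_spec (h : IsEigensystem G lam w) (hcard : 2 ≤ Fintype.card V) {k₀ : V}
    (hk₀ : lam k₀ = 1) :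
    (∀ k ≠ k₀, lam k ≤ secondEigenvalue G) ∧ ∃ k ≠ k₀, lam k = secondEigenvalue G := by
  have hl : (transitionEigenvalues G : Multiset ℝ) = (univ : Finset V).val.map lam := by
    rw [transitionEigenvalues, Multiset.sort_eq, h.roots_eq]
  have hpair : (transitionEigenvalues G).Pairwise (· ≥ ·) := Multiset.pairwise_sort _ _
  have hlen : (transitionEigenvalues G).length = Fintype.card V := by
    rw [← Multiset.coe_card, hl, Multiset.card_map]
    rfl
  unfold secondEigenvalue
  generalize transitionEigenvalues G = l at *
  match l, hlen with
  | [], hlen => simp at hlen; omega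
  | [a], hlen => simp at hlen; omega
  | a :: b :: t, _ =>
    have hge : 1 ≤ a := by
      have : (1 : ℝ) ∈ ((a :: b :: t : List ℝ) : Multiset ℝ) := by
        rw [hl, ← hk₀]
        exact Multiset.mem_map_of_mem _ (mem_univ k₀)
      rcases List.mem_cons.1 (Multiset.mem_coe.1 this) with h1 | h1
      · exact h1.le
      · exact List.rel_of_pairwise_cons hpair h1
    have hle : a ≤ 1 := by
      have : a ∈ (univ : Finset V).val.map lam := by
        rw [← hl]
        simp
      obtain ⟨k, -, rfl⟩ := Multiset.mem_map.1 this
      exact h.le_one k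
    -- The head of the sorted list is `1`, so cancelling it leaves the eigenvalues with index other
    -- than `k₀`; entry 1 is their maximum.
    have hrest : ((b :: t : List ℝ) : Multiset ℝ) = (univ.erase k₀).val.map lam := by
      rw [← Multiset.cons_inj_right (1 : ℝ)]
      nth_rewrite 2 [← hk₀]
      rw [← Multiset.map_cons, Finset.erase_val, Multiset.cons_erase (mem_univ_val k₀), ← hl,
        ← Multiset.cons_coe, le_antisymm hle hge]
      rfl
    constructor
    · intro k hk
      have : lam k ∈ ((b :: t : List ℝ) : Multiset ℝ) := by
        rw [hrest]
        exact Multiset.mem_map_of_mem _ (mem_erase.2 ⟨hk, mem_univ k⟩)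
      rcases List.mem_cons.1 (Multiset.mem_coe.1 this) with h1 | h1
      · simp [h1]
      · simpa using List.rel_of_pairwise_cons (List.pairwise_cons.1 hpair).2 h1
    · have : b ∈ (univ.erase k₀).val.map lam := by
        rw [← hrest]
        simp
      obtain ⟨k, hk, hkb⟩ := Multiset.mem_map.1 this
      exact ⟨k, (mem_erase.1 hk).1, by simpa using hkb⟩

theorem sum_erase_eq (h : IsEigensystem G lam w) {k₀ : V} (hk₀ : lam k₀ = 1) :
    ∑ k ∈ univ.erase k₀, lam k = -1 := by
  have := Finset.sum_erase_add univ lam (mem_univ k₀)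
  rw [h.sum_eigenvalues, hk₀] at this
  linarith

theorem cast_card_erase (k₀ : V) :
    (((univ : Finset V).erase k₀).card : ℝ) = (Fintype.card V : ℝ) - 1 := by
  rw [card_erase_of_mem (mem_univ k₀), card_univ, Nat.cast_pred (Fintype.card_pos_iff.2 ⟨k₀⟩)]

/-- At least two eigenvalues remain and they sum to `-1`, so they cannot all be at most `-1`. The
upper bound is the simplicity of the eigenvalue `1`. -/
theorem secondEigenvalue_mem_Ioo (h : IsEigensystem G lam w) (hG : G.Connected)
    (hcard : 3 ≤ Fintype.card V) {k₀ : V} (hk₀ : lam k₀ = 1) :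
    -1 < secondEigenvalue G ∧ secondEigenvalue G < 1 := by
  obtain ⟨hle, k, hk, hkb⟩ := h.secondEigenvalue_spec (by omega) hk₀
  constructor
  · have := Finset.sum_le_card_nsmul (univ.erase k₀) lam (secondEigenvalue G)
      fun k hk => hle k (mem_erase.1 hk).1
    rw [h.sum_erase_eq hk₀, nsmul_eq_mul, cast_card_erase] at this
    have hN : (3 : ℝ) ≤ Fintype.card V := by exact_mod_cast hcard
    by_contra! hb
    nlinarith
  · rw [← hkb]
    exact lt_of_le_of_ne (h.le_one k) fun h1 => hk (h.eq_of_eq_one hG h1 hk₀)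

/-- The contribution of one eigenfunction to the diagonal sum `2|E| ∑ 1 / d`. -/
theorem sum_mass (h : IsEigensystem G lam w) :
    ∑ k, 2 * (G.edgeFinset.card : ℝ) * ∑ j, w k j * w k j =
      2 * (G.edgeFinset.card : ℝ) * ∑ j, 1 / (G.degree j : ℝ) := by
  rw [← Finset.mul_sum, Finset.sum_comm]
  simp [h.resolution]

omit [DecidableEq V] in
theorem mass_of_sq {k : V} (hk : ∀ v, 2 * (G.edgeFinset.card : ℝ) * (w k v * w k v) = 1) :
    2 * (G.edgeFinset.card : ℝ) * ∑ j, w k j * w k j = Fintype.card V := by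
  simp [Finset.mul_sum, hk]

theorem sum_le_bipartiteBound (h : IsEigensystem G lam w) (hG : G.Connected)
    (hbip : G.IsBipartite) (hcard : 3 ≤ Fintype.card V) {k₀ : V} (hk₀ : lam k₀ = 1) {k₁ : V}
    (hk₁ : lam k₁ = -1) :
    ∑ k ∈ univ.erase k₀,
        (Fintype.card V + 2 * (G.edgeFinset.card : ℝ) * ∑ j, w k j * w k j) / (1 - lam k) ≤
      bipartiteBound G := by
  obtain ⟨hb, hb1⟩ := h.secondEigenvalue_mem_Ioo hG hcard hk₀
  obtain ⟨hle, -⟩ := h.secondEigenvalue_spec (by omega) hk₀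
  have hmem : k₁ ∈ univ.erase k₀ :=
    mem_erase.2 ⟨fun h0 => by rw [h0, hk₀] at hk₁; norm_num at hk₁, mem_univ _⟩
  have hK := sum_inv_le (n := Fintype.card V) (K := kParam G) hb hb1 rfl ⟨k₁, hmem⟩
    (cast_card_erase k₀) lam
    (fun k hk => ⟨h.neg_one_le hbip k, hle k (mem_erase.1 hk).1⟩) (h.sum_erase_eq hk₀)
  have hmass := h.sum_mass
  have hm0 := mass_of_sq (h.sq_of_eq_one hG hk₀)
  have hm1 := mass_of_sq (h.sq_of_eq_neg_one hG hbip hk₁)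
  set W : V → ℝ := fun k => 2 * (G.edgeFinset.card : ℝ) * ∑ j, w k j * w k j with hW
  change ∑ k, W k = _ at hmass
  change W k₀ = _ at hm0
  change W k₁ = _ at hm1
  rw [← Finset.sum_erase_add _ _ (mem_univ k₀), ← Finset.sum_erase_add _ _ hmem, hm0, hm1] at hmass
  -- The index `k₁` is kept apart: its exact denominator `2` gives the term `N/2`.
  have hrest : ∑ k ∈ (univ.erase k₀).erase k₁, W k / (1 - lam k) ≤
      (∑ k ∈ (univ.erase k₀).erase k₁, W k) / (1 - secondEigenvalue G) := by
    rw [Finset.sum_div]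
    refine Finset.sum_le_sum fun k hk => ?_
    have := hle k (mem_erase.1 (mem_erase.1 hk).2).1
    refine div_le_div_of_nonneg_left ?_ (by linarith) (by linarith)
    exact mul_nonneg (by positivity) (Finset.sum_nonneg fun j _ => mul_self_nonneg _)
  have hsplit : ∑ k ∈ univ.erase k₀, (Fintype.card V + W k) / (1 - lam k) =
      Fintype.card V * ∑ k ∈ univ.erase k₀, 1 / (1 - lam k) +
        (∑ k ∈ (univ.erase k₀).erase k₁, W k / (1 - lam k) + (Fintype.card V : ℝ) / 2) := by
    have : (Fintype.card V : ℝ) / 2 = W k₁ / (1 - lam k₁) := by rw [hm1, hk₁]; norm_num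
    rw [this, Finset.sum_erase_add _ (fun k => W k / (1 - lam k)) hmem, Finset.mul_sum,
      ← Finset.sum_add_distrib]
    exact Finset.sum_congr rfl fun k _ => by ring
  rw [hsplit]
  have hN := mul_le_mul_of_nonneg_left hK (Nat.cast_nonneg (α := ℝ) (Fintype.card V))
  rw [show ∑ k ∈ (univ.erase k₀).erase k₁, W k =
    2 * (G.edgeFinset.card : ℝ) * ∑ j, 1 / (G.degree j : ℝ) - 2 * Fintype.card V by
      linarith] at hrest
  refine (add_le_add hN (add_le_add_left hrest _)).trans (le_of_eq ?_)
  rw [bipartiteBound, thetaParam]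
  ring

/-- Apart from `1` and `-1` the eigenvalues are nonpositive with sum `0`, so they all vanish. -/
theorem sum_eq_of_secondEigenvalue_eq_zero (h : IsEigensystem G lam w) (hG : G.Connected)
    (hbip : G.IsBipartite) (hcard : 3 ≤ Fintype.card V) {k₀ : V} (hk₀ : lam k₀ = 1) {k₁ : V}
    (hk₁ : lam k₁ = -1) (hb : secondEigenvalue G = 0) :
    ∑ k ∈ univ.erase k₀,
        (Fintype.card V + 2 * (G.edgeFinset.card : ℝ) * ∑ j, w k j * w k j) / (1 - lam k) =
      Fintype.card V * (Fintype.card V - 3 : ℝ) +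
        2 * (G.edgeFinset.card : ℝ) * ∑ j, 1 / (G.degree j : ℝ) := by
  obtain ⟨hle, -⟩ := h.secondEigenvalue_spec (by omega) hk₀
  have hmem : k₁ ∈ univ.erase k₀ :=
    mem_erase.2 ⟨fun h0 => by rw [h0, hk₀] at hk₁; norm_num at hk₁, mem_univ _⟩
  have hmass := h.sum_mass
  have hm0 := mass_of_sq (h.sq_of_eq_one hG hk₀)
  have hm1 := mass_of_sq (h.sq_of_eq_neg_one hG hbip hk₁)
  have hsum := h.sum_erase_eq hk₀
  rw [← Finset.sum_erase_add _ _ hmem, hk₁] at hsum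
  have hzero : ∀ k ∈ (univ.erase k₀).erase k₁, lam k = 0 :=
    (Finset.sum_eq_zero_iff_of_nonpos fun k hk =>
      (hle k (mem_erase.1 (mem_erase.1 hk).2).1).trans hb.le).1 (by linarith)
  rw [← Finset.sum_erase_add _ _ (mem_univ k₀), ← Finset.sum_erase_add _ _ hmem, hm0, hm1] at hmass
  rw [← Finset.sum_erase_add _ _ hmem, hm1, hk₁,
    Finset.sum_congr rfl fun k hk => by rw [hzero k hk, sub_zero, div_one],
    Finset.sum_add_distrib, Finset.sum_const, nsmul_eq_mul, ← hmass, card_erase_of_mem hmem,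
    Nat.cast_pred (card_pos.2 ⟨k₁, hmem⟩), cast_card_erase]
  ring

/-- If any two neighbors of a vertex have the same neighbors, then the only eigenvalues of the
random walk are `0`, `1` and `-1`. -/
theorem eq_zero_or_sq_eq_one (h : IsEigensystem G lam w) (hd : ∀ v, 0 < G.degree v)
    (hN : ∀ v x y, G.Adj v x → G.Adj v y → G.neighborFinset x = G.neighborFinset y) (k : V) :
    lam k = 0 ∨ lam k ^ 2 = 1 := by
  refine or_iff_not_imp_left.2 fun h0 => ?_
  have hd' : ∀ v, (G.degree v : ℝ) ≠ 0 := fun v => by exact_mod_cast (hd v).ne'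
  -- For `lam k ≠ 0`, equal neighbourhoods force equal values at all neighbours of `v`, so the
  -- eigenvalue equation at `v` involves a single value. Using it along an edge in both directions
  -- gives `lam k ^ 2 = 1`.
  have hadj : ∀ v x, G.Adj v x → lam k * w k v = w k x := by
    intro v x hvx
    have hconst : ∀ y ∈ G.neighborFinset v, w k y = w k x := by
      intro y hy
      have hxy := hN v y x ((SimpleGraph.mem_neighborFinset _ _ _).1 hy) hvx
      have h1 := h.sum_neighbors k y
      rw [hxy, h.sum_neighbors k x, ← SimpleGraph.card_neighborFinset_eq_degree,
        ← SimpleGraph.card_neighborFinset_eq_degree, hxy,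
        SimpleGraph.card_neighborFinset_eq_degree] at h1
      exact (mul_left_cancel₀ (mul_ne_zero h0 (hd' x)) h1).symm
    have h1 := h.sum_neighbors k v
    rw [Finset.sum_congr rfl hconst, Finset.sum_const, nsmul_eq_mul,
      SimpleGraph.card_neighborFinset_eq_degree] at h1
    refine mul_left_cancel₀ (hd' v) ?_
    linarith
  obtain ⟨v, hv⟩ : ∃ v, w k v ≠ 0 := by
    by_contra! hw
    simpa [hw] using h.norm_eq k
  obtain ⟨x, hx⟩ := (G.degree_pos_iff_exists_adj v).1 (hd v)
  refine mul_right_cancel₀ hv ?_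
  linear_combination lam k * hadj v x hx + hadj x v hx.symm

end IsEigensystem

theorem bipartiteBound_of_secondEigenvalue_eq_zero {V : Type*} [Fintype V] [DecidableEq V]
    {G : SimpleGraph V} [DecidableRel G.Adj] (hb : secondEigenvalue G = 0) :
    bipartiteBound G = Fintype.card V * (Fintype.card V - 3 : ℝ) +
        2 * (G.edgeFinset.card : ℝ) * ∑ j, 1 / (G.degree j : ℝ) := by
  have hk : kParam G = 1 := by simp [kParam, hb]
  rw [bipartiteBound, thetaParam, hk, hb]
  norm_num
  ring

/-! ### The index as a sum over ordered pairs -/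

theorem additiveDegreeKirchhoff_eq_sum {N : ℕ} (G : SimpleGraph (Fin N)) [DecidableRel G.Adj]
    (hsymm : ∀ i j, effectiveResistance G i j = effectiveResistance G j i)
    (hself : ∀ i, effectiveResistance G i i = 0) :
    additiveDegreeKirchhoff G = ∑ i, ∑ j, (G.degree i : ℝ) * effectiveResistance G i j := by
  have := Finset.sum_sum_Ioi_add_eq_sum_sum_off_diag
    (fun j i : Fin N => (G.degree i : ℝ) * effectiveResistance G i j)
  rw [additiveDegreeKirchhoff]
  calc _ = ∑ i, ∑ j ∈ Ioi i, ((G.degree i : ℝ) * effectiveResistance G i j +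
        (G.degree j : ℝ) * effectiveResistance G j i) :=
        Finset.sum_congr rfl fun i _ => Finset.sum_congr rfl fun j _ => by
          rw [hsymm j i]
          ring
    _ = _ := by
        rw [this]
        refine Finset.sum_congr rfl fun i _ => ?_
        refine Finset.sum_subset (subset_univ _) fun j _ hj => ?_
        have : j = i := by simpa using hj
        rw [this, hself, mul_zero]

theorem IsEigensystem.additiveDegreeKirchhoff_eq {N : ℕ} {G : SimpleGraph (Fin N)}
    [DecidableRel G.Adj] {lam : Fin N → ℝ} {w : Fin N → Fin N → ℝ} (h : IsEigensystem G lam w)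
    (hG : G.Connected) (hd : ∀ v, 0 < G.degree v) {k₀ : Fin N} (hk₀ : lam k₀ = 1) :
    additiveDegreeKirchhoff G = ∑ k ∈ univ.erase k₀,
      (Fintype.card (Fin N) + 2 * (G.edgeFinset.card : ℝ) * ∑ j, w k j * w k j) / (1 - lam k) := by
  rw [← h.sum_degree_mul_effectiveResistance hG hd hk₀]
  refine additiveDegreeKirchhoff_eq_sum G (fun i j => ?_) fun i => ?_
  · rw [h.effectiveResistance_eq_sum hG hd hk₀, h.effectiveResistance_eq_sum hG hd hk₀]
    exact Finset.sum_congr rfl fun k _ => by ring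
  · rw [h.effectiveResistance_eq_sum hG hd hk₀]
    simp

/-! ### Balanced complete bipartite graphs and stars -/

theorem degree_of_iso_completeBipartiteGraph {V : Type*} [Fintype V] {G : SimpleGraph V}
    [DecidableRel G.Adj] {m : ℕ} (e : G ≃g completeBipartiteGraph (Fin m) (Fin m)) (v : V) :
    G.degree v = m := by
  classical
  rw [← SimpleGraph.card_neighborSet_eq_degree, Fintype.card_congr (e.mapNeighborSet v)]
  rcases e v with i | i
  · rw [Fintype.card_congr (β := Fin m) ⟨fun x => x.1.elim id id, fun j => ⟨.inr j, by simp⟩, ?_, ?_⟩,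
      Fintype.card_fin]
    · rintro ⟨x | x, hx⟩ <;> simp at hx ⊢
    · intro j; rfl
  · rw [Fintype.card_congr (β := Fin m) ⟨fun x => x.1.elim id id, fun j => ⟨.inl j, by simp⟩, ?_, ?_⟩,
      Fintype.card_fin]
    · rintro ⟨x | x, hx⟩ <;> simp at hx ⊢
    · intro j; rfl

theorem neighborFinset_eq_of_iso_completeBipartiteGraph {V : Type*} [Fintype V]
    {G : SimpleGraph V} [DecidableRel G.Adj] {m : ℕ}
    (e : G ≃g completeBipartiteGraph (Fin m) (Fin m)) (v x y : V) (hx : G.Adj v x)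
    (hy : G.Adj v y) : G.neighborFinset x = G.neighborFinset y := by
  ext z
  simp only [SimpleGraph.mem_neighborFinset, ← e.map_adj_iff] at hx hy ⊢
  generalize e v = v', e x = x', e y = y', e z = z' at *
  rcases v' with a | a <;> rcases x' with b | b <;> rcases y' with c | c <;>
    simp_all

theorem neighborFinset_eq_starGraph {V : Type*} [Fintype V] {c : V}
    [DecidableRel (SimpleGraph.starGraph c).Adj] (v x y : V)
    (hx : (SimpleGraph.starGraph c).Adj v x) (hy : (SimpleGraph.starGraph c).Adj v y) :
    (SimpleGraph.starGraph c).neighborFinset x = (SimpleGraph.starGraph c).neighborFinset y := by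
  ext z
  simp only [SimpleGraph.mem_neighborFinset, SimpleGraph.starGraph_adj] at hx hy ⊢
  grind

theorem degree_starGraph {V : Type*} [Fintype V] [DecidableEq V] {c : V}
    [DecidableRel (SimpleGraph.starGraph c).Adj] (v : V) :
    ((SimpleGraph.starGraph c).degree v : ℝ) = if v = c then (Fintype.card V : ℝ) - 1 else 1 := by
  split_ifs with hv
  · subst hv
    rw [← Nat.cast_pred (Fintype.card_pos_iff.2 ⟨v⟩), ← SimpleGraph.degree_starGraph_center (r := v)]
    congr!
  · rw [← Nat.cast_one, ← SimpleGraph.degree_starGraph_of_ne_center hv]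
    congr!

end DegreeKirchhoff

open DegreeKirchhoff in
theorem mainTheorem7 (N : ℕ) (hN : 3 ≤ N) (G : SimpleGraph (Fin N)) [DecidableRel G.Adj]
    (hconn : G.Connected) (hbip : G.IsBipartite) :
    -- the denominators in the bound and in its parameters do not vanish
    (-1 < DegreeKirchhoff.secondEigenvalue G ∧ DegreeKirchhoff.secondEigenvalue G < 1 ∧
      0 < DegreeKirchhoff.thetaParam G) ∧
    -- the upper bound
    DegreeKirchhoff.additiveDegreeKirchhoff G ≤ DegreeKirchhoff.bipartiteBound G ∧
    -- it is exact for the star on `N` vertices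
    ((∃ c : Fin N, G = SimpleGraph.starGraph c) →
      DegreeKirchhoff.additiveDegreeKirchhoff G = DegreeKirchhoff.bipartiteBound G ∧
      DegreeKirchhoff.bipartiteBound G = 3 * (N : ℝ) ^ 2 - 7 * (N : ℝ) + 4) ∧
    -- it is exact for the balanced complete bipartite graph (then `N = 2 * m`)
    ((∃ m : ℕ, Nonempty (G ≃g completeBipartiteGraph (Fin m) (Fin m))) →
      DegreeKirchhoff.additiveDegreeKirchhoff G = DegreeKirchhoff.bipartiteBound G ∧
      DegreeKirchhoff.bipartiteBound G = (N : ℝ) * (2 * (N : ℝ) - 3)) := by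
  have : Nontrivial (Fin N) := Fin.nontrivial_iff_two_le.2 (by omega)
  have hcard : 3 ≤ Fintype.card (Fin N) := by simpa using hN
  have hN' : (3 : ℝ) ≤ N := by exact_mod_cast hN
  have hd : ∀ v, 0 < G.degree v := fun v => hconn.preconnected.degree_pos_of_nontrivial v
  obtain ⟨lam, w, h⟩ := exists_isEigensystem G hd
  obtain ⟨k₀, hk₀⟩ := h.exists_eq_one hd
  obtain ⟨k₁, hk₁⟩ := h.exists_eq_neg_one hd hbip
  obtain ⟨hb, hb1⟩ := h.secondEigenvalue_mem_Ioo hconn hcard hk₀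
  have hθ := (theta_bounds (n := Fintype.card (Fin N)) (K := kParam G) hb rfl).1
  have hR := h.additiveDegreeKirchhoff_eq hconn hd hk₀
  -- Both extremal families satisfy this neighbourhood condition, which forces `λ₂ = 0`; only the
  -- degree sums then remain to be evaluated.
  have hexact : (∀ v x y, G.Adj v x → G.Adj v y → G.neighborFinset x = G.neighborFinset y) →
      additiveDegreeKirchhoff G = bipartiteBound G ∧
      bipartiteBound G = N * (N - 3 : ℝ) +
        (∑ j, (G.degree j : ℝ)) * ∑ j, 1 / (G.degree j : ℝ) := by
    intro hnbr
    have hb0 : secondEigenvalue G = 0 := by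
      obtain ⟨k, -, hk⟩ := (h.secondEigenvalue_spec (by omega) hk₀).2
      rw [← hk] at hb hb1 ⊢
      refine (h.eq_zero_or_sq_eq_one hd hnbr k).resolve_right fun h1 => ?_
      nlinarith
    have hB := bipartiteBound_of_secondEigenvalue_eq_zero hb0
    rw [cast_sum_degrees, hR, h.sum_eq_of_secondEigenvalue_eq_zero hconn hbip hcard hk₀ hk₁ hb0, hB]
    simp
  refine ⟨⟨hb, hb1, ?_⟩, ?_, ?_, ?_⟩
  · change 0 < secondEigenvalue G * (Fintype.card (Fin N) - kParam G - 2) - kParam G + 2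
    linarith
  · exact hR.trans_le (h.sum_le_bipartiteBound hconn hbip hcard hk₀ hk₁)
  · rintro ⟨c, rfl⟩
    obtain ⟨h1, h2⟩ := hexact neighborFinset_eq_starGraph
    refine ⟨h1, h2.trans ?_⟩
    have hs1 : ∑ j, ((SimpleGraph.starGraph c).degree j : ℝ) = 2 * ((N : ℝ) - 1) := by
      rw [← Finset.sum_erase_add _ _ (mem_univ c), Finset.sum_congr rfl fun j hj => by
        rw [degree_starGraph, if_neg (mem_erase.1 hj).1], degree_starGraph, if_pos rfl,
        Finset.sum_const, nsmul_eq_mul, IsEigensystem.cast_card_erase, Fintype.card_fin]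
      ring
    have hs2 : ∑ j, 1 / ((SimpleGraph.starGraph c).degree j : ℝ) = (N - 1) + 1 / (N - 1) := by
      rw [← Finset.sum_erase_add _ _ (mem_univ c), Finset.sum_congr rfl fun j hj => by
        rw [degree_starGraph, if_neg (mem_erase.1 hj).1], degree_starGraph, if_pos rfl,
        Finset.sum_const, nsmul_eq_mul, IsEigensystem.cast_card_erase, Fintype.card_fin]
      ring
    rw [hs1, hs2]
    have : (N : ℝ) - 1 ≠ 0 := by linarith
    field_simp
    ring
  · rintro ⟨m, ⟨e⟩⟩
    obtain ⟨h1, h2⟩ := hexact (neighborFinset_eq_of_iso_completeBipartiteGraph e)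
    refine ⟨h1, h2.trans ?_⟩
    have hNm : (N : ℝ) = 2 * m := by
      have := Fintype.card_congr e.toEquiv
      simp only [Fintype.card_fin, Fintype.card_sum] at this
      rw [this]
      push_cast
      ring
    have hm : (m : ℝ) ≠ 0 := by
      intro h0
      linarith
    simp only [degree_of_iso_completeBipartiteGraph e, Finset.sum_const, card_univ,
      Fintype.card_fin, nsmul_eq_mul]
    rw [hNm]
    field_simp
    ring
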